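/- Fix a prime power $q$. There is a function $\eta:\mathbb{N}\to\mathbb{R}$, depending only on $q$, with $\eta(r)=o(r)$ as $r\to\infty$, such that the following holds. Let $F\in\mathbb{F}_q[T]$ have degree $r$, let $a\in\mathbb{F}_q[T]$, let $m$ be an integer with $1\le m\le r$, and put $d=\deg\gcd(a,F)$. For $x\in\mathbb{F}_q[T]$ coprime to $F$ let $\overline{x}$ be the unique polynomial of degree less than $r$ with $x\overline{x}\equiv 1 \pmod F$. For $x_0\in\mathbb{F}_q[T]$ let $\mathcal{I}_m=\{x+x_0 : x\in\mathbb{F}_q[T],\ \deg x<m\}$ (where $\deg 0=-\infty$), and let $I_{F,a}(\mathcal{I}_m)$ be the number of pairs $(x_1,x_2)\in\mathcal{I}_m^2$ with $x_1,x_2$ coprime to $F$ and $\overline{x}_1+\overline{x}_2\equiv a\pmod F$. Write $I_{F,a}(m)$ for this number when $x_0=0$. Then $$I_{F,a}(m)\le q^{\eta(r)}\left(1+q^{3m/2-r/2}+q^{2m+d-r}\right).$$ If moreover $F$ is irreducible, then for every $x_0\in\mathbb{F}_q[T]$ $$I_{F,a}(\mathcal{I}_m)\le q^{\eta(r)}\left(1+q^{3m/2-r/2}+q^{2m+d-r}\right).$$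 -/

import Mathlib

open Polynomial Filter Asymptotics

namespace FqPoly

/-- The interval `{x + x₀ : deg x < m}` in `K[X]`; it has `q ^ m` elements when `#K = q`.
It is called initial when `x₀ = 0`. -/
def interval {K : Type*} [Field K] (x₀ : K[X]) (m : ℕ) : Set K[X] :=
  {y | ∃ x : K[X], x.degree < (m : WithBot ℕ) ∧ y = x + x₀}

/-- Every polynomial coprime to `F ≠ 0` has exactly one inverse modulo `F` of degree less than
`deg F`. -/
theorem existsUnique_inverse {K : Type*} [Field K] {F x : K[X]} (hF : F ≠ 0)
    (hx : IsCoprime x F) : ∃! y : K[X], y.degree < F.degree ∧ F ∣ x * y - 1 := by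
  obtain ⟨u, v, h⟩ := hx
  refine ⟨u % F, ⟨EuclideanDomain.mod_lt u hF, ?_⟩, ?_⟩
  · refine ⟨-v - x * (u / F), ?_⟩
    have h2 := EuclideanDomain.div_add_mod u F
    linear_combination h + x * h2
  · rintro y ⟨hy, z, hz⟩
    have h2 := EuclideanDomain.div_add_mod u F
    have hd : F ∣ y - u % F :=
      ⟨u * z + v * y + u / F, by linear_combination u * hz - y * h - h2⟩
    have hlt : (y - u % F).degree < F.degree :=
      lt_of_le_of_lt (degree_sub_le _ _) (max_lt hy (EuclideanDomain.mod_lt u hF))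
    exact sub_eq_zero.mp (eq_zero_of_dvd_of_degree_lt hd hlt)

open Classical in
/-- For `x` coprime to `F`, the unique polynomial `x̄` of degree less than `deg F` such that
`x x̄ ≡ 1 (mod F)`. The default value `0` is never used: the counting function below only
looks at `x` coprime to `F`. -/
noncomputable def inverseMod {K : Type*} [Field K] (F x : K[X]) : K[X] :=
  if h : ∃ y : K[X], y.degree < F.degree ∧ F ∣ x * y - 1 then h.choose else 0

theorem inverseMod_spec {K : Type*} [Field K] {F x : K[X]} (hF : F ≠ 0) (hx : IsCoprime x F) :
    (inverseMod F x).degree < F.degree ∧ F ∣ x * inverseMod F x - 1 := by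
  have h : ∃ y : K[X], y.degree < F.degree ∧ F ∣ x * y - 1 := (existsUnique_inverse hF hx).exists
  rw [inverseMod, dif_pos h]
  exact h.choose_spec

/-- The pairs `(x₁, x₂) ∈ S²`, both entries coprime to `F` (so that the inverses exist), with
`x̄₁ + x̄₂ ≡ a (mod F)`. -/
def inverseSumPairs {K : Type*} [Field K] (F a : K[X]) (S : Set K[X]) : Set (K[X] × K[X]) :=
  {p | p.1 ∈ S ∧ p.2 ∈ S ∧ IsCoprime p.1 F ∧ IsCoprime p.2 F ∧
    F ∣ inverseMod F p.1 + inverseMod F p.2 - a}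

/-- The counting function `I_{F,a}(S)`. -/
noncomputable def inverseSumCount {K : Type*} [Field K] (F a : K[X]) (S : Set K[X]) : ℕ :=
  (inverseSumPairs F a S).ncard

theorem interval_finite {K : Type*} [Field K] [Finite K] (x₀ : K[X]) (m : ℕ) :
    (interval x₀ m).Finite := by
  have h : Finite (degreeLT K m) := Finite.of_equiv _ (degreeLTEquiv K m).symm.toEquiv
  refine (Set.finite_range (fun x : degreeLT K m => (x : K[X]) + x₀)).subset ?_
  rintro y ⟨x, hx, rfl⟩
  exact ⟨⟨x, mem_degreeLT.mpr hx⟩, rfl⟩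

/-- The set counted is finite for intervals over a finite field, so `ncard` is its true size. -/
theorem inverseSumPairs_finite {K : Type*} [Field K] [Finite K] (F a x₀ : K[X]) (m : ℕ) :
    (inverseSumPairs F a (interval x₀ m)).Finite :=
  ((interval_finite x₀ m).prod (interval_finite x₀ m)).subset fun _ hp => ⟨hp.1, hp.2.1⟩

end FqPoly

namespace FqPoly

variable {K : Type*} [Field K]

/-! Clearing inverses turns the condition into x₁ + x₂ ≡ a x₁x₂ (mod F). Thue's lemma
(`exists_small_multiple`) supplies a multiplier making both coefficients small, so that α x₁x₂ +
β(x₁ + x₂) has degree below some L and lies in a fixed class mod F. It then takes at most q^(L - r)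
values (exponent truncated at 0). For each value t, (αx₁ + β)(αx₂ + β) = αt + β², so the pairs are
controlled by divisors of one polynomial (`ncard_pairs_le`). The divisor bound makes that factor
q^(o(r)), and the free degree k in Thue's lemma is chosen to minimise L.

With x₀ = 0 and D = gcd(a, F), Thue is applied to a/D modulo F/D. With F irreducible and F ∤ a,
dividing by a leaves x₀ in only one nonconstant coefficient, which Thue can reduce. If F ∣ a, the
trivial bound q^m suffices. -/

/-! ### Initial intervals, Thue's lemma and residue classes. -/

theorem mem_interval_zero {m : ℕ} {y : K[X]} :
    y ∈ interval 0 m ↔ y.degree < (m : WithBot ℕ) := by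
  simp [interval]

theorem mem_interval_zero_of_natDegree_lt {m : ℕ} {y : K[X]} (h : y.natDegree < m) :
    y ∈ interval 0 m :=
  mem_interval_zero.mpr (degree_le_natDegree.trans_lt (by exact_mod_cast h))

theorem natDegree_lt_of_mem_interval_zero {m : ℕ} (hm : 1 ≤ m) {y : K[X]}
    (h : y ∈ interval 0 m) : y.natDegree < m := by
  rcases eq_or_ne y 0 with rfl | h0
  · simpa using Nat.lt_of_lt_of_le Nat.zero_lt_one hm
  · exact (natDegree_lt_iff_degree_lt h0).mpr (mem_interval_zero.mp h)

theorem ncard_interval_zero [Fintype K] (m : ℕ) :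
    (interval (0 : K[X]) m).ncard = Fintype.card K ^ m := by
  have h : interval (0 : K[X]) m = (degreeLT K m : Set K[X]) := by
    ext y
    rw [mem_interval_zero, SetLike.mem_coe, mem_degreeLT]
  rw [h, ← Nat.card_coe_set_eq]
  have := Nat.card_congr (degreeLTEquiv K m).toEquiv
  simpa using this

/-- Thue's lemma for polynomials. -/
theorem exists_small_multiple [Fintype K] {F : K[X]} (hF : F ≠ 0) (b : K[X]) {k : ℕ}
    (hk : k ≤ F.natDegree) :
    ∃ u v : K[X], u ≠ 0 ∧ u.natDegree ≤ k ∧ F ∣ b * u - v ∧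
      v.degree < ((F.natDegree - k : ℕ) : WithBot ℕ) := by
  have hX : (X ^ (F.natDegree - k) : K[X]) ≠ 0 := pow_ne_zero _ X_ne_zero
  -- Pigeonhole: the quotient records the top k coefficients of b u mod F, giving q^k boxes for
  -- q^(k+1) choices of u.
  have hmaps : ∀ u ∈ interval (0 : K[X]) (k + 1),
      (b * u % F) / X ^ (F.natDegree - k) ∈ interval (0 : K[X]) k := by
    intro u _
    rw [mem_interval_zero]
    have h1 : (b * u % F).degree < F.degree := EuclideanDomain.mod_lt _ hF
    rcases eq_or_ne ((b * u % F) / X ^ (F.natDegree - k)) 0 with h0 | h0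
    · rw [h0, degree_zero]; exact WithBot.bot_lt_coe k
    · have hle : (X ^ (F.natDegree - k) : K[X]).degree ≤ (b * u % F).degree := by
        by_contra! hlt
        exact h0 ((Polynomial.div_eq_zero_iff hX).mpr hlt)
      have h2 := degree_add_div hX hle
      have h3 : b * u % F ≠ 0 := by
        rintro h; simp [h] at h0
      rw [degree_X_pow, degree_eq_natDegree h0, degree_eq_natDegree h3] at h2
      rw [degree_eq_natDegree h3, degree_eq_natDegree hF] at h1
      rw [degree_eq_natDegree h0]
      norm_cast at *
      omega
  obtain ⟨u₁, h₁, u₂, h₂, hne, heq⟩ := Set.exists_ne_map_eq_of_ncard_lt_of_maps_to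
    (by rw [ncard_interval_zero, ncard_interval_zero]
        exact Nat.pow_lt_pow_right Fintype.one_lt_card (Nat.lt_succ_self k)) hmaps
    (interval_finite 0 k)
  refine ⟨u₁ - u₂, b * u₁ % F - b * u₂ % F, sub_ne_zero.mpr hne, ?_, ?_, ?_⟩
  · have h₁' := natDegree_lt_of_mem_interval_zero (by omega) h₁
    have h₂' := natDegree_lt_of_mem_interval_zero (by omega) h₂
    exact (natDegree_sub_le _ _).trans (by omega)
  · refine ⟨b * u₁ / F - b * u₂ / F, ?_⟩
    have e₁ := EuclideanDomain.div_add_mod (b * u₁) F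
    have e₂ := EuclideanDomain.div_add_mod (b * u₂) F
    linear_combination e₂ - e₁
  · have e₁ := EuclideanDomain.div_add_mod (b * u₁ % F) (X ^ (F.natDegree - k))
    have e₂ := EuclideanDomain.div_add_mod (b * u₂ % F) (X ^ (F.natDegree - k))
    have e : b * u₁ % F - b * u₂ % F =
        b * u₁ % F % X ^ (F.natDegree - k) - b * u₂ % F % X ^ (F.natDegree - k) := by
      rw [heq] at e₁
      linear_combination e₂ - e₁
    rw [e]
    refine (degree_sub_le _ _).trans_lt (max_lt ?_ ?_)
    · exact (EuclideanDomain.mod_lt (b * u₁ % F) hX).trans_eq (degree_X_pow _)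
    · exact (EuclideanDomain.mod_lt (b * u₂ % F) hX).trans_eq (degree_X_pow _)

/-- A residue class modulo `F` meets an initial interval in few polynomials. -/
theorem ncard_residue_class_le [Fintype K] {F : K[X]} (hF : F ≠ 0) (γ : K[X]) (L : ℕ) :
    {t : K[X] | t ∈ interval 0 L ∧ F ∣ t + γ}.ncard ≤
      Fintype.card K ^ (L - F.natDegree) := by
  rcases Set.eq_empty_or_nonempty {t : K[X] | t ∈ interval 0 L ∧ F ∣ t + γ} with h | ⟨t₀, h₀⟩
  · rw [h]; simp
  rw [← ncard_interval_zero]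
  have key : ∀ t ∈ {t : K[X] | t ∈ interval 0 L ∧ F ∣ t + γ}, ∃ z, t - t₀ = F * z := by
    rintro t ⟨-, s, hs⟩
    obtain ⟨-, s₀, hs₀⟩ := h₀
    exact ⟨s - s₀, by linear_combination hs - hs₀⟩
  refine Set.ncard_le_ncard_of_injOn (fun t => (t - t₀) / F) ?_ ?_ (interval_finite 0 _)
  · intro t ht
    obtain ⟨z, hz⟩ := key t ht
    have hd : (F * z).degree < (L : WithBot ℕ) := by
      rw [← hz]
      exact (degree_sub_le _ _).trans_lt
        (max_lt (mem_interval_zero.mp ht.1) (mem_interval_zero.mp h₀.1))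
    simp only [hz, mul_div_cancel_left₀ _ hF]
    rw [mem_interval_zero]
    rcases eq_or_ne z 0 with rfl | h0
    · rw [degree_zero]; exact WithBot.bot_lt_coe _
    · rw [degree_mul, degree_eq_natDegree hF, degree_eq_natDegree h0] at hd
      rw [degree_eq_natDegree h0]
      norm_cast at *
      omega
  · intro t ht t' ht' h
    obtain ⟨z, hz⟩ := key t ht
    obtain ⟨z', hz'⟩ := key t' ht'
    simp only [hz, hz', mul_div_cancel_left₀ _ hF] at h
    rw [← h] at hz'
    linear_combination hz - hz'

/-! ### The divisor bound. -/

section Divisors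

theorem setOf_dvd_subset_interval {N : K[X]} (hN : N ≠ 0) {n : ℕ} (hn : N.natDegree ≤ n) :
    {d : K[X] | d ∣ N} ⊆ interval 0 (n + 1) := fun d hd =>
  mem_interval_zero_of_natDegree_lt (by have := natDegree_le_of_dvd hd hN; omega)

variable [Fintype K]

theorem finite_setOf_dvd {N : K[X]} (hN : N ≠ 0) : {d : K[X] | d ∣ N}.Finite :=
  (interval_finite 0 _).subset (setOf_dvd_subset_interval hN le_rfl)

theorem ncard_setOf_dvd_le {N : K[X]} (hN : N ≠ 0) {n : ℕ} (hn : N.natDegree ≤ n) :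
    {d : K[X] | d ∣ N}.ncard ≤ Fintype.card K ^ (n + 1) := by
  rw [← ncard_interval_zero]
  exact Set.ncard_le_ncard (setOf_dvd_subset_interval hN hn) (interval_finite 0 _)

theorem ncard_setOf_dvd_prime_pow_mul_le {p N : K[X]} (hp : Prime p) (hN : N ≠ 0) (e : ℕ) :
    {d : K[X] | d ∣ p ^ e * N}.ncard ≤ (e + 1) * {d : K[X] | d ∣ N}.ncard := by
  have hsub : {d : K[X] | d ∣ p ^ e * N} ⊆
      (fun x : ℕ × K[X] => p ^ x.1 * x.2) '' ((Finset.range (e + 1) : Set ℕ) ×ˢ {d | d ∣ N}) := by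
    intro d hd
    obtain ⟨d₁, d₂, h₁, h₂, rfl⟩ := exists_dvd_and_dvd_of_dvd_mul hd
    obtain ⟨i, hi, w, hw⟩ := (dvd_prime_pow hp e).mp h₁
    refine ⟨(i, ↑w⁻¹ * d₂), ⟨by simpa using Nat.lt_succ_of_le hi, ?_⟩, ?_⟩
    · exact (Units.mul_left_dvd).mpr h₂
    · simp only [← hw, mul_assoc, Units.mul_inv_cancel_left]
  have hfin : ((Finset.range (e + 1) : Set ℕ) ×ˢ {d : K[X] | d ∣ N}).Finite :=
    (Finset.finite_toSet _).prod (finite_setOf_dvd hN)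
  refine (Set.ncard_le_ncard hsub (hfin.image _)).trans ((Set.ncard_image_le hfin).trans ?_)
  rw [Set.ncard_prod, Set.ncard_coe_finset, Finset.card_range]

/-- A prime of degree at least k at most doubles the count, which B ^ deg p ≥ 2 pays for. Each prime
of smaller degree costs a constant factor, and `s` lists the finitely many allowed, associates
included. -/
theorem exists_ncard_setOf_dvd_le_of_smallFactors {B : ℝ} (hB : 1 < B) {k : ℕ} (hk : 2 ≤ B ^ k)
    (s : Finset K[X]) :
    ∃ C : ℝ, 0 < C ∧ ∀ N : K[X], N ≠ 0 →
      (∀ p, Prime p → p ∣ N → p.natDegree < k → p ∈ s) →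
      ({d : K[X] | d ∣ N}.ncard : ℝ) ≤ C * B ^ N.natDegree := by
  classical
  induction s using Finset.induction_on with
  | empty =>
    refine ⟨Fintype.card K, by exact_mod_cast Fintype.card_pos, fun N => ?_⟩
    induction N using UniqueFactorizationMonoid.induction_on_prime with
    | h₁ => intro h; exact absurd rfl h
    | h₂ x hx =>
      intro h0 _
      rw [natDegree_eq_zero_of_isUnit hx, pow_zero, mul_one]
      simpa using (by exact_mod_cast ncard_setOf_dvd_le h0 (natDegree_eq_zero_of_isUnit hx).le :
        ({d : K[X] | d ∣ x}.ncard : ℝ) ≤ (Fintype.card K : ℝ) ^ (0 + 1))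
    | h₃ a p ha hp ih =>
      intro h0 h
      have h1 := ih ha fun p' hp' hd => h p' hp' (hd.mul_left p)
      have hdeg : k ≤ p.natDegree := by
        by_contra! hlt
        exact absurd (h p hp (dvd_mul_right p a) hlt) (Finset.notMem_empty p)
      have h2 : ({d : K[X] | d ∣ p * a}.ncard : ℝ) ≤ 2 * {d : K[X] | d ∣ a}.ncard := by
        have := ncard_setOf_dvd_prime_pow_mul_le hp ha 1
        rw [pow_one] at this
        exact_mod_cast this
      have h3 : 2 ≤ B ^ p.natDegree := hk.trans (pow_le_pow_right₀ hB.le hdeg)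
      rw [natDegree_mul hp.ne_zero ha, pow_add]
      calc _ ≤ _ := h2
        _ ≤ B ^ p.natDegree * (Fintype.card K * B ^ a.natDegree) := by gcongr
        _ = _ := by ring
  | insert p s _ ih =>
    obtain ⟨C, hC, ih⟩ := ih
    have hB' : 0 < B - 1 := sub_pos.mpr hB
    refine ⟨(1 + 1 / (B - 1)) * C, by positivity, fun N hN h => ?_⟩
    have hone : (1 : ℝ) ≤ 1 + 1 / (B - 1) := le_add_of_nonneg_right (by positivity)
    by_cases hp : Prime p ∧ p ∣ N
    · obtain ⟨hp, -⟩ := hp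
      obtain ⟨N', hN', hnd⟩ := (FiniteMultiplicity.of_prime_left hp hN).exists_eq_pow_mul_and_not_dvd
      generalize multiplicity p N = e at hN'
      have hN0 : N' ≠ 0 := by rintro rfl; exact hnd (dvd_zero p)
      have h1 := ih N' hN0 fun p' hp' hd hlt => by
        rcases Finset.mem_insert.mp (h p' hp' (hN' ▸ hd.mul_left _) hlt) with rfl | h'
        · exact absurd hd hnd
        · exact h'
      have h2 : ({d : K[X] | d ∣ p ^ e * N'}.ncard : ℝ) ≤ (e + 1) * {d : K[X] | d ∣ N'}.ncard := by
        exact_mod_cast ncard_setOf_dvd_prime_pow_mul_le hp hN0 e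
      have hpdeg : 1 ≤ p.natDegree := hp.irreducible.natDegree_pos
      -- Bernoulli's inequality: the constant absorbs the factor e + 1 uniformly in e.
      have h3 : (e + 1 : ℝ) ≤ (1 + 1 / (B - 1)) * B ^ (e * p.natDegree) := by
        have h4 : 1 + (e : ℝ) * (B - 1) ≤ B ^ e := by
          have := one_add_mul_le_pow (a := B - 1) (by linarith) e
          simpa using this
        have h5 : B ^ e ≤ B ^ (e * p.natDegree) :=
          pow_le_pow_right₀ hB.le (Nat.le_mul_of_pos_right e hpdeg)
        calc (e + 1 : ℝ) ≤ 1 + e * (B - 1) + (1 / (B - 1) + e) := by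
              have : 0 ≤ (e : ℝ) * (B - 1) := by positivity
              have : 0 ≤ 1 / (B - 1) := by positivity
              linarith
          _ = (1 + 1 / (B - 1)) * (1 + e * (B - 1)) := by field_simp
          _ ≤ _ := by gcongr; exact h4.trans h5
      rw [hN', natDegree_mul (pow_ne_zero _ hp.ne_zero) hN0, natDegree_pow, pow_add]
      calc _ ≤ _ := h2
        _ ≤ ((1 + 1 / (B - 1)) * B ^ (e * p.natDegree)) * (C * B ^ N'.natDegree) := by gcongr
        _ = _ := by ring
    · refine (ih N hN fun p' hp' hd hlt => ?_).trans ?_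
      · rcases Finset.mem_insert.mp (h p' hp' hd hlt) with rfl | h'
        · exact absurd ⟨hp', hd⟩ hp
        · exact h'
      · have : 0 ≤ C * B ^ N.natDegree := by positivity
        rw [mul_assoc]
        exact le_mul_of_one_le_left this hone

theorem exists_ncard_setOf_dvd_le {B : ℝ} (hB : 1 < B) :
    ∃ C : ℝ, 0 < C ∧ ∀ N : K[X], N ≠ 0 →
      ({d : K[X] | d ∣ N}.ncard : ℝ) ≤ C * B ^ N.natDegree := by
  obtain ⟨k, hk⟩ := pow_unbounded_of_one_lt 2 hB
  obtain ⟨C, hC, h⟩ := exists_ncard_setOf_dvd_le_of_smallFactors hB hk.le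
    (interval_finite (0 : K[X]) k).toFinset
  refine ⟨C, hC, fun N hN => h N hN fun p _ _ hlt => ?_⟩
  simpa using mem_interval_zero_of_natDegree_lt hlt

variable (K) in
/-- The largest number of divisors of a nonzero polynomial of degree at most `n`. -/
noncomputable def maxDivisorCount (n : ℕ) : ℕ :=
  sSup {c | ∃ N : K[X], N ≠ 0 ∧ N.natDegree ≤ n ∧ {d : K[X] | d ∣ N}.ncard = c}

theorem ncard_setOf_dvd_le_maxDivisorCount {N : K[X]} (hN : N ≠ 0) {n : ℕ}
    (hn : N.natDegree ≤ n) : {d : K[X] | d ∣ N}.ncard ≤ maxDivisorCount K n :=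
  le_csSup ⟨Fintype.card K ^ (n + 1), by rintro _ ⟨N, hN, hn, rfl⟩; exact ncard_setOf_dvd_le hN hn⟩
    ⟨N, hN, hn, rfl⟩

theorem one_le_maxDivisorCount (n : ℕ) : 1 ≤ maxDivisorCount K n := by
  refine le_trans ?_ (ncard_setOf_dvd_le_maxDivisorCount (one_ne_zero (α := K[X])) (by simp))
  exact (Set.ncard_pos (finite_setOf_dvd one_ne_zero)).mpr ⟨1, one_dvd _⟩

theorem exists_maxDivisorCount_le {B : ℝ} (hB : 1 < B) :
    ∃ C : ℝ, 0 < C ∧ ∀ n : ℕ, (maxDivisorCount K n : ℝ) ≤ C * B ^ n := by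
  obtain ⟨C, hC, h⟩ := exists_ncard_setOf_dvd_le (K := K) hB
  refine ⟨C, hC, fun n => ?_⟩
  obtain ⟨N, hN, hn, hc⟩ : maxDivisorCount K n ∈
      {c | ∃ N : K[X], N ≠ 0 ∧ N.natDegree ≤ n ∧ {d : K[X] | d ∣ N}.ncard = c} :=
    Nat.sSup_mem ⟨_, 1, one_ne_zero, by simp, rfl⟩ ⟨Fintype.card K ^ (n + 1), by
      rintro _ ⟨N, hN, hn, rfl⟩; exact ncard_setOf_dvd_le hN hn⟩
  rw [← hc]
  exact (h N hN).trans (by gcongr; exact hB.le)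

theorem logb_maxDivisorCount_isLittleO :
    (fun r : ℕ => Real.logb (Fintype.card K) (3 * maxDivisorCount K (4 * r))) =o[atTop]
      (fun r : ℕ => (r : ℝ)) := by
  have hq : (1 : ℝ) < Fintype.card K := by exact_mod_cast Fintype.one_lt_card
  rw [isLittleO_iff]
  intro ε hε
  -- With B = q^(ε/8), B^(4r) = q^(εr/2); the other half of εr absorbs the constant 3C.
  obtain ⟨C, hC, h⟩ := exists_maxDivisorCount_le (K := K)
    (B := (Fintype.card K : ℝ) ^ (ε / 8)) (Real.one_lt_rpow hq (by positivity))
  have hlim : Tendsto (fun r : ℕ => ε / 2 * (r : ℝ)) atTop atTop :=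
    tendsto_natCast_atTop_atTop.const_mul_atTop (by positivity)
  filter_upwards [hlim.eventually_ge_atTop (Real.logb (Fintype.card K) (3 * C))] with r hr
  have hT : (1 : ℝ) ≤ maxDivisorCount K (4 * r) := by exact_mod_cast one_le_maxDivisorCount _
  rw [Real.norm_of_nonneg (Real.logb_nonneg hq (by linarith)),
    Real.norm_of_nonneg (Nat.cast_nonneg r)]
  calc Real.logb (Fintype.card K) (3 * maxDivisorCount K (4 * r))
      ≤ Real.logb (Fintype.card K) (3 * C * (Fintype.card K : ℝ) ^ (ε / 2 * r)) := by
        refine Real.logb_le_logb_of_le hq (by positivity) ?_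
        have e : (Fintype.card K : ℝ) ^ (ε / 2 * r) =
            ((Fintype.card K : ℝ) ^ (ε / 8)) ^ (4 * r) := by
          rw [← Real.rpow_mul_natCast (by positivity)]
          congr 1
          push_cast
          ring
        rw [e, mul_assoc]
        gcongr
        exact h _
    _ = Real.logb (Fintype.card K) (3 * C) + ε / 2 * r := by
        rw [Real.logb_mul (by positivity) (by positivity),
          Real.logb_rpow (by positivity) hq.ne']
    _ ≤ ε * r := by linarith

end Divisors

/-! ### Counting pairs through a factorisation. -/

/-- The degenerate case, where the divisor bound says nothing: a vanishing factor fixes one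
coordinate, and injectivity fixes the other. -/
theorem ncard_le_two_of_mul_eq_zero {α β : K[X]} (hα : α ≠ 0) {S : Set (K[X] × K[X])}
    (h₁ : Set.InjOn Prod.fst S) (h₂ : Set.InjOn Prod.snd S)
    (hS : ∀ p ∈ S, (α * p.1 + β) * (α * p.2 + β) = 0) : S.ncard ≤ 2 := by
  have hsub : S ⊆ {p ∈ S | α * p.1 + β = 0} ∪ {p ∈ S | α * p.2 + β = 0} := fun p hp =>
    (mul_eq_zero.mp (hS p hp)).imp (fun h => ⟨hp, h⟩) (fun h => ⟨hp, h⟩)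
  have s₁ : {p ∈ S | α * p.1 + β = 0}.Subsingleton := fun p hp p' hp' =>
    h₁ hp.1 hp'.1 (mul_left_cancel₀ hα (by linear_combination hp.2 - hp'.2))
  have s₂ : {p ∈ S | α * p.2 + β = 0}.Subsingleton := fun p hp p' hp' =>
    h₂ hp.1 hp'.1 (mul_left_cancel₀ hα (by linear_combination hp.2 - hp'.2))
  have := s₁.finite.to_subtype
  have c₁ := Set.ncard_le_one_iff_subsingleton.mpr s₁
  have := s₂.finite.to_subtype
  have c₂ := Set.ncard_le_one_iff_subsingleton.mpr s₂
  have := Set.ncard_le_ncard hsub (s₁.finite.union s₂.finite)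
  have := Set.ncard_union_le {p ∈ S | α * p.1 + β = 0} {p ∈ S | α * p.2 + β = 0}
  omega

theorem ncard_le_of_mul_eq [Fintype K] {α β N : K[X]} (hα : α ≠ 0) {n : ℕ}
    {S : Set (K[X] × K[X])} (h₁ : Set.InjOn Prod.fst S) (h₂ : Set.InjOn Prod.snd S)
    (hS : ∀ p ∈ S, (α * p.1 + β) * (α * p.2 + β) = N) (hN : S.Nonempty → N.natDegree ≤ n) :
    S.ncard ≤ 3 * maxDivisorCount K n := by
  have hT := one_le_maxDivisorCount (K := K) n
  rcases S.eq_empty_or_nonempty with rfl | hne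
  · simp
  rcases eq_or_ne N 0 with rfl | h0
  · have := ncard_le_two_of_mul_eq_zero hα h₁ h₂ hS
    omega
  · refine le_trans ?_ ((ncard_setOf_dvd_le_maxDivisorCount h0 (hN hne)).trans
      (Nat.le_mul_of_pos_left _ (by norm_num)))
    refine Set.ncard_le_ncard_of_injOn (fun p => α * p.1 + β)
      (fun p hp => ⟨_, (hS p hp).symm⟩) ?_ (finite_setOf_dvd h0)
    intro p hp p' hp' h
    exact h₁ hp hp' (mul_left_cancel₀ hα (add_right_cancel h))

/-- Fibre count for the map f below: its values are small and lie in one class mod F, and each fibre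
injects into divisors of αt + β² unless that is 0. -/
theorem ncard_pairs_le [Fintype K] {F α β γ : K[X]} (hF : F ≠ 0) (hα : α ≠ 0) {m n L : ℕ}
    (hm : 1 ≤ m) {S : Set (K[X] × K[X])}
    (hS : ∀ p ∈ S, p.1 ∈ interval 0 m ∧ p.2 ∈ interval 0 m)
    (h₁ : Set.InjOn Prod.fst S) (h₂ : Set.InjOn Prod.snd S)
    (hdvd : ∀ p ∈ S, F ∣ α * (p.1 * p.2) + β * (p.1 + p.2) + γ)
    (hαL : α.natDegree + 2 * m < L + 2) (hβL : β.natDegree + m < L + 1)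
    (hαn : α.natDegree + m ≤ n) (hβn : β.natDegree ≤ n) :
    S.ncard ≤ 3 * maxDivisorCount K (2 * n) * Fintype.card K ^ (L - F.natDegree) := by
  classical
  have hfin : S.Finite :=
    ((interval_finite 0 m).prod (interval_finite 0 m)).subset fun p hp => hS p hp
  have hdeg : ∀ p ∈ S, p.1.natDegree < m ∧ p.2.natDegree < m := fun p hp =>
    ⟨natDegree_lt_of_mem_interval_zero hm (hS p hp).1,
      natDegree_lt_of_mem_interval_zero hm (hS p hp).2⟩
  set f : K[X] × K[X] → K[X] := fun p => α * (p.1 * p.2) + β * (p.1 + p.2) with hf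
  have hfib : ∀ t, {p ∈ S | f p = t}.ncard ≤ 3 * maxDivisorCount K (2 * n) := by
    intro t
    have hprod : ∀ p ∈ {p ∈ S | f p = t}, (α * p.1 + β) * (α * p.2 + β) = α * t + β ^ 2 := by
      rintro p ⟨-, rfl⟩
      simp only [hf]
      ring
    refine ncard_le_of_mul_eq hα (h₁.mono (Set.sep_subset _ _)) (h₂.mono (Set.sep_subset _ _))
      hprod ?_
    rintro ⟨p, hp⟩
    rw [← hprod p hp]
    obtain ⟨hd₁, hd₂⟩ := hdeg p hp.1
    have key : ∀ y : K[X], y.natDegree < m → (α * y + β).natDegree ≤ n := fun y hy =>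
      (natDegree_add_le _ _).trans (max_le (natDegree_mul_le.trans (by omega)) hβn)
    exact natDegree_mul_le.trans (by have := key _ hd₁; have := key _ hd₂; omega)
  have himg : (f '' S).ncard ≤ Fintype.card K ^ (L - F.natDegree) := by
    refine (Set.ncard_le_ncard ?_ ((interval_finite 0 L).subset (Set.sep_subset _ _))).trans
      (ncard_residue_class_le hF γ L)
    rintro _ ⟨p, hp, rfl⟩
    obtain ⟨hd₁, hd₂⟩ := hdeg p hp
    refine ⟨mem_interval_zero_of_natDegree_lt ?_, hdvd p hp⟩
    refine (natDegree_add_le _ _).trans_lt (max_lt ?_ ?_)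
    · have := natDegree_mul_le (p := α) (q := p.1 * p.2)
      have := natDegree_mul_le (p := p.1) (q := p.2)
      omega
    · have := natDegree_mul_le (p := β) (q := p.1 + p.2)
      have := natDegree_add_le p.1 p.2
      omega
  have hcard := Finset.card_le_mul_card_image (f := f) hfin.toFinset
    (3 * maxDivisorCount K (2 * n)) fun t _ => by
      refine le_trans (le_of_eq ?_) (hfib t)
      rw [← Set.ncard_coe_finset]
      congr 1
      ext p
      simp
  rw [Set.ncard_eq_toFinset_card S hfin]
  refine hcard.trans (Nat.mul_le_mul_left _ (le_trans (le_of_eq ?_) himg))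
  rw [← Set.ncard_coe_finset, Finset.coe_image, hfin.coe_toFinset]

/-! ### The congruence satisfied by the pairs. -/

/-- Translation of the coordinates of the pairs by `-x₀`. -/
def translatedPairs (F a x₀ : K[X]) (m : ℕ) : Set (K[X] × K[X]) :=
  (fun p : K[X] × K[X] => (p.1 - x₀, p.2 - x₀)) '' inverseSumPairs F a (interval x₀ m)

theorem ncard_translatedPairs (F a x₀ : K[X]) (m : ℕ) :
    (translatedPairs F a x₀ m).ncard = inverseSumCount F a (interval x₀ m) :=
  Set.ncard_image_of_injective _ fun p p' h => by
    simp only [Prod.mk.injEq, sub_left_inj] at h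
    exact Prod.ext h.1 h.2

theorem translatedPairs_mem_interval {F a x₀ : K[X]} {m : ℕ} {p : K[X] × K[X]}
    (hp : p ∈ translatedPairs F a x₀ m) : p.1 ∈ interval 0 m ∧ p.2 ∈ interval 0 m := by
  obtain ⟨⟨_, _⟩, ⟨⟨x, hx, rfl⟩, ⟨y, hy, rfl⟩, -⟩, rfl⟩ := hp
  simpa [mem_interval_zero] using And.intro hx hy

theorem translatedPairs_dvd {F a x₀ : K[X]} (hF : F ≠ 0) {m : ℕ} {p : K[X] × K[X]}
    (hp : p ∈ translatedPairs F a x₀ m) :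
    F ∣ (p.1 + x₀) + (p.2 + x₀) - a * ((p.1 + x₀) * (p.2 + x₀)) := by
  obtain ⟨⟨x, y⟩, ⟨-, -, hx, hy, w, hw⟩, rfl⟩ := hp
  obtain ⟨s, hs⟩ := (inverseMod_spec hF hx).2
  obtain ⟨t, ht⟩ := (inverseMod_spec hF hy).2
  refine ⟨x * y * w - y * s - x * t, ?_⟩
  simp only [sub_add_cancel] at *
  linear_combination x * y * hw - y * hs - x * ht

theorem eq_of_dvd_inverseMod_sub {F x y : K[X]} (hF : F ≠ 0) (hx : IsCoprime x F)
    (hy : IsCoprime y F) (h : F ∣ inverseMod F x - inverseMod F y)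
    (hd : (x - y).degree < F.degree) : x = y := by
  obtain ⟨s, hs⟩ := (inverseMod_spec hF hx).2
  obtain ⟨t, ht⟩ := (inverseMod_spec hF hy).2
  obtain ⟨w, hw⟩ := h
  refine sub_eq_zero.mp (eq_zero_of_dvd_of_degree_lt ⟨y * s - x * t - x * y * w, ?_⟩ hd)
  linear_combination y * hs - x * ht - x * y * hw

/-- One coordinate determines the other modulo F, and since m ≤ deg F distinct elements of the
interval are incongruent. -/
theorem translatedPairs_injOn {F a x₀ : K[X]} (hF : F ≠ 0) {m : ℕ} (hm : m ≤ F.natDegree) :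
    Set.InjOn Prod.fst (translatedPairs F a x₀ m) ∧
      Set.InjOn Prod.snd (translatedPairs F a x₀ m) := by
  have hdeg : ∀ x ∈ interval x₀ m, ∀ y ∈ interval x₀ m, (x - y).degree < F.degree := by
    rintro _ ⟨x, hx, rfl⟩ _ ⟨y, hy, rfl⟩
    rw [add_sub_add_right_eq_sub, degree_eq_natDegree hF]
    exact (degree_sub_le _ _).trans_lt
      ((max_lt hx hy).trans_le (by exact_mod_cast hm))
  constructor
  · rintro _ ⟨⟨x, y⟩, ⟨hx, hy, cx, cy, h⟩, rfl⟩ _ ⟨⟨x', y'⟩, ⟨hx', hy', cx', cy', h'⟩, rfl⟩ he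
    simp only [sub_left_inj] at he h h' hx hy hx' hy' cx cy cx' cy'
    subst he
    have : F ∣ inverseMod F y - inverseMod F y' := by
      simpa using dvd_sub h h'
    rw [eq_of_dvd_inverseMod_sub hF cy cy' this (hdeg _ hy _ hy')]
  · rintro _ ⟨⟨x, y⟩, ⟨hx, hy, cx, cy, h⟩, rfl⟩ _ ⟨⟨x', y'⟩, ⟨hx', hy', cx', cy', h'⟩, rfl⟩ he
    simp only [sub_left_inj] at he h h' hx hy hx' hy' cx cy cx' cy'
    subst he
    have : F ∣ inverseMod F x - inverseMod F x' := by
      simpa using dvd_sub h h'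
    rw [eq_of_dvd_inverseMod_sub hF cx cx' this (hdeg _ hx _ hx')]

variable [Fintype K]

theorem inverseSumCount_le_card_pow {F a x₀ : K[X]} (hF : F ≠ 0) {m : ℕ}
    (hm : m ≤ F.natDegree) :
    inverseSumCount F a (interval x₀ m) ≤ Fintype.card K ^ m := by
  rw [← ncard_translatedPairs, ← ncard_interval_zero]
  exact Set.ncard_le_ncard_of_injOn Prod.fst (fun p hp => (translatedPairs_mem_interval hp).1)
    (translatedPairs_injOn hF hm).1 (interval_finite 0 m)

/-- From a'u ≡ v (mod F'), multiplying the congruence by u gives α = vD and β = -u, with deg α < deg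
F - k and deg β ≤ k. -/
theorem inverseSumCount_initial_le {F a D F' a' : K[X]} (hF : F ≠ 0) (hFD : F = D * F')
    (ha : a = D * a') (hco : IsCoprime a' F') {m k : ℕ} (hm : 1 ≤ m) (hmF : m ≤ F.natDegree)
    (hk : k < F'.natDegree) :
    inverseSumCount F a (interval 0 m) ≤ 3 * maxDivisorCount K (4 * F.natDegree) *
      Fintype.card K ^ (max (F.natDegree + 2 * m - k - 2) (k + m) - F.natDegree) := by
  have hD : D ≠ 0 := by rintro rfl; simp [hFD] at hF
  have hF' : F' ≠ 0 := by rintro rfl; simp [hFD] at hF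
  have hr : F.natDegree = D.natDegree + F'.natDegree := by rw [hFD, natDegree_mul hD hF']
  obtain ⟨u, v, hu, huk, hdvd, hv⟩ := exists_small_multiple hF' a' hk.le
  -- If v = 0, coprimality gives F' ∣ u, impossible as deg u ≤ k < deg F'.
  have hv0 : v ≠ 0 := by
    rintro rfl
    rw [sub_zero] at hdvd
    have := natDegree_le_of_dvd (hco.symm.dvd_of_dvd_mul_left hdvd) hu
    omega
  have hvk : v.natDegree < F'.natDegree - k := (natDegree_lt_iff_degree_lt hv0).mpr hv
  have hα : (v * D).natDegree = v.natDegree + D.natDegree := natDegree_mul hv0 hD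
  rw [← ncard_translatedPairs]
  obtain ⟨i₁, i₂⟩ := translatedPairs_injOn (a := a) (x₀ := 0) hF hmF
  have := ncard_pairs_le (α := v * D) (β := -u) (γ := 0) (n := 2 * F.natDegree)
    (L := max (F.natDegree + 2 * m - k - 2) (k + m)) hF (mul_ne_zero hv0 hD) hm
    (fun p hp => translatedPairs_mem_interval hp) i₁ i₂ (fun p hp => ?_)
    (by omega) (by rw [natDegree_neg]; omega) (by omega) (by rw [natDegree_neg]; omega)
  · rwa [← mul_assoc] at this
  · obtain ⟨s, hs⟩ := translatedPairs_dvd hF hp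
    obtain ⟨t, ht⟩ := hdvd
    refine ⟨-(u * s) - t * p.1 * p.2, ?_⟩
    subst ha
    subst hFD
    linear_combination -u * hs - D * p.1 * p.2 * ht

/-- With b inverse to a, the shifted congruence is y₁y₂ + (x₀ - b)(y₁ + y₂) + x₀² - 2x₀b ≡ 0. Thue
for x₀ - b gives α = u, β = v; the constant term only selects the residue class. -/
theorem inverseSumCount_irreducible_le {F a x₀ : K[X]} (hF : Irreducible F) (ha : ¬F ∣ a)
    {m k : ℕ} (hm : 1 ≤ m) (hmF : m ≤ F.natDegree) (hk : k + m ≤ F.natDegree) :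
    inverseSumCount F a (interval x₀ m) ≤ 3 * maxDivisorCount K (4 * F.natDegree) *
      Fintype.card K ^ (max (k + 2 * m - 1) (F.natDegree - k + m - 1) - F.natDegree) := by
  obtain ⟨c, b, hcb⟩ := hF.coprime_iff_not_dvd.mpr ha
  obtain ⟨u, v, hu, huk, hdvd, hv⟩ := exists_small_multiple hF.ne_zero (x₀ - b)
    (show k ≤ F.natDegree by omega)
  have hvk : v.natDegree < F.natDegree - k :=
    natDegree_lt_of_mem_interval_zero (by omega) (mem_interval_zero.mpr hv)
  rw [← ncard_translatedPairs]
  obtain ⟨i₁, i₂⟩ := translatedPairs_injOn (a := a) (x₀ := x₀) hF.ne_zero hmF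
  have := ncard_pairs_le (α := u) (β := v) (γ := u * (x₀ ^ 2 - 2 * x₀ * b))
    (n := 2 * F.natDegree)
    (L := max (k + 2 * m - 1) (F.natDegree - k + m - 1)) hF.ne_zero hu hm
    (fun p hp => translatedPairs_mem_interval hp) i₁ i₂ (fun p hp => ?_)
    (by omega) (by omega) (by omega) (by omega)
  · rwa [← mul_assoc] at this
  · obtain ⟨s, hs⟩ := translatedPairs_dvd hF.ne_zero hp
    obtain ⟨t, ht⟩ := hdvd
    refine ⟨-(u * b * s) + u * c * ((p.1 + x₀) * (p.2 + x₀)) - t * (p.1 + p.2), ?_⟩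
    linear_combination (-u * b) * hs - u * (p.1 + x₀) * (p.2 + x₀) * hcb - (p.1 + p.2) * ht

end FqPoly

/-! ### Balancing the exponents. -/

open FqPoly in
theorem lemma5p3 {K : Type*} [Field K] [Fintype K] [DecidableEq K] (q : ℕ)
    (hq : Fintype.card K = q) :
    ∃ η : ℕ → ℝ, η =o[atTop] (fun r : ℕ => (r : ℝ)) ∧
      ∀ (F a : K[X]) (r d m : ℕ), F.natDegree = r → (EuclideanDomain.gcd a F).natDegree = d →
        1 ≤ m → m ≤ r →
        (FqPoly.inverseSumCount F a (FqPoly.interval 0 m) : ℝ) ≤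
            (q : ℝ) ^ (η r) * (1 + (q : ℝ) ^ (3 * (m : ℝ) / 2 - (r : ℝ) / 2)
              + (q : ℝ) ^ (2 * (m : ℝ) + (d : ℝ) - (r : ℝ))) ∧
        (Irreducible F → ∀ x₀ : K[X],
          (FqPoly.inverseSumCount F a (FqPoly.interval x₀ m) : ℝ) ≤
            (q : ℝ) ^ (η r) * (1 + (q : ℝ) ^ (3 * (m : ℝ) / 2 - (r : ℝ) / 2)
              + (q : ℝ) ^ (2 * (m : ℝ) + (d : ℝ) - (r : ℝ)))) := by
  subst hq
  refine ⟨_, logb_maxDivisorCount_isLittleO (K := K), fun F a r d m hr hd hm hmr => ?_⟩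
  have hF : F ≠ 0 := by rintro rfl; simp at hr; omega
  have hq : (1 : ℝ) < Fintype.card K := by exact_mod_cast Fintype.one_lt_card
  have hT : (1 : ℝ) ≤ maxDivisorCount K (4 * r) := by exact_mod_cast one_le_maxDivisorCount _
  rw [Real.rpow_logb (by positivity) hq.ne' (by positivity)]
  set Q : ℝ := (Fintype.card K : ℝ) with hQ
  have hpos : ∀ x : ℝ, 0 < Q ^ x := fun x => Real.rpow_pos_of_pos (by positivity) x
  -- It suffices that the exponent of the bound is at most one of the three exponents.
  have main : ∀ c e : ℕ, c ≤ 3 * maxDivisorCount K (4 * r) * Fintype.card K ^ e →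
      (e : ℝ) ≤ 0 ∨ (e : ℝ) ≤ 3 * (m : ℝ) / 2 - (r : ℝ) / 2 ∨
        (e : ℝ) ≤ 2 * (m : ℝ) + (d : ℝ) - (r : ℝ) →
      (c : ℝ) ≤ 3 * maxDivisorCount K (4 * r) * (1 + Q ^ (3 * (m : ℝ) / 2 - (r : ℝ) / 2)
              + Q ^ (2 * (m : ℝ) + (d : ℝ) - (r : ℝ))) := by
    intro c e hc he
    have hc' : (c : ℝ) ≤ 3 * maxDivisorCount K (4 * r) * Q ^ (e : ℝ) := by
      rw [Real.rpow_natCast, hQ]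
      exact_mod_cast hc
    refine hc'.trans (mul_le_mul_of_nonneg_left ?_ (by positivity))
    have h₁ := hpos (3 * (m : ℝ) / 2 - (r : ℝ) / 2)
    have h₂ := hpos (2 * (m : ℝ) + (d : ℝ) - (r : ℝ))
    rcases he with he | he | he
    all_goals have h := Real.rpow_le_rpow_of_exponent_le hq.le he
    · rw [Real.rpow_zero] at h; linarith
    · linarith
    · linarith
  have trivialBound : d = r → ∀ x₀, (inverseSumCount F a (interval x₀ m) : ℝ) ≤
      3 * maxDivisorCount K (4 * r) * (1 + Q ^ (3 * (m : ℝ) / 2 - (r : ℝ) / 2)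
              + Q ^ (2 * (m : ℝ) + (d : ℝ) - (r : ℝ))) := by
    intro hdr x₀
    refine main _ m ((inverseSumCount_le_card_pow hF (hmr.trans_eq hr.symm)).trans
      (Nat.le_mul_of_pos_left _ ?_)) (Or.inr (Or.inr ?_))
    · have := one_le_maxDivisorCount (K := K) (4 * r)
      omega
    · rw [hdr]
      have : (0 : ℝ) ≤ m := Nat.cast_nonneg m
      linarith
  have hD0 : EuclideanDomain.gcd a F ≠ 0 := fun h => hF (EuclideanDomain.gcd_eq_zero_iff.mp h).2
  obtain ⟨F', hF'⟩ := EuclideanDomain.gcd_dvd_right a F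
  obtain ⟨a', ha'⟩ := EuclideanDomain.gcd_dvd_left a F
  have hdr : r = d + F'.natDegree := by
    have hF'0 : F' ≠ 0 := by rintro rfl; rw [mul_zero] at hF'; exact hF hF'
    rw [← hr, ← hd, ← natDegree_mul hD0 hF'0, ← hF']
  refine ⟨?_, fun hirr x₀ => ?_⟩
  · rcases Nat.eq_zero_or_pos F'.natDegree with h0 | hpos'
    · exact trivialBound (by omega) 0
    have hco : IsCoprime a' F' := by
      refine ⟨EuclideanDomain.gcdA a F, EuclideanDomain.gcdB a F, mul_left_cancel₀ hD0 ?_⟩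
      have := EuclideanDomain.gcd_eq_gcd_ab a F
      linear_combination -this - EuclideanDomain.gcdA a F * ha' - EuclideanDomain.gcdB a F * hF'
    -- (r + m)/2 - 1 balances r + 2m - k - 2 against k + m and yields (3m - r)/2; the cap deg F' - 1
    -- = r - d - 1, when active, yields the term 2m + d - r.
    obtain ⟨k, hk⟩ : ∃ k, k = min (F'.natDegree - 1) ((r + m) / 2 - 1) := ⟨_, rfl⟩
    have := inverseSumCount_initial_le hF hF' ha' hco hm (hmr.trans_eq hr.symm)
      (show k < F'.natDegree by omega)
    rw [hr] at this
    refine main _ _ this ?_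
    generalize he : max (r + 2 * m - k - 2) (k + m) - r = e
    have h : e ≤ 0 ∨ 2 * e + r ≤ 3 * m ∨ e + r ≤ 2 * m + d := by omega
    rcases h with h | h | h
    · exact Or.inl (by exact_mod_cast h)
    · have h' : 2 * (e : ℝ) + r ≤ 3 * m := by exact_mod_cast h
      exact Or.inr (Or.inl (by linarith))
    · have h' : (e : ℝ) + r ≤ 2 * m + d := by exact_mod_cast h
      exact Or.inr (Or.inr (by linarith))
  · by_cases hFa : F ∣ a
    · refine trivialBound ?_ x₀
      have := natDegree_le_of_dvd (EuclideanDomain.dvd_gcd hFa dvd_rfl) hD0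
      omega
    -- Balances k + 2m against r - k + m; the -1 in both degree bounds absorbs the rounding.
    obtain ⟨k, hk⟩ : ∃ k, k = (r - m) / 2 := ⟨_, rfl⟩
    have := inverseSumCount_irreducible_le (x₀ := x₀) hirr hFa hm (hmr.trans_eq hr.symm)
      (show k + m ≤ F.natDegree by omega)
    rw [hr] at this
    refine main _ _ this ?_
    generalize he : max (k + 2 * m - 1) (r - k + m - 1) - r = e
    have h : e ≤ 0 ∨ 2 * e + r ≤ 3 * m := by omega
    rcases h with h | h
    · exact Or.inl (by exact_mod_cast h)
    · have h' : 2 * (e : ℝ) + r ≤ 3 * m := by exact_mod_cast h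
      exact Or.inr (Or.inl (by linarith))
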